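/- Let $D$ be an integral domain with quotient field $K$, and let $\star$ be a semistar operation on $D$, i.e. a map $E\mapsto E^\star$ from the set of nonzero $D$-submodules of $K$ to itself such that, for all nonzero $x\in K$ and all $E,F$: $(xE)^\star=xE^\star$; $E\subseteq F$ implies $E^\star\subseteq F^\star$; $E\subseteq E^\star$ and $(E^\star)^\star=E^\star$. Put $E^{\star_f}:=\bigcup F^\star$, the union over all nonzero finitely generated $D$-submodules $F\subseteq E$. A quasi-$\star_f$-maximal ideal is a maximal element of the set of all proper nonzero ideals $I$ of $D$ with $I^{\star_f}\cap D=I$ (such maximal elements are prime). Let $\widetilde\star$ be the semistar operation $E^{\widetilde\star}:=\bigcap_P ED_P$, the intersection over all quasi-$\star_f$-maximal ideals $P$ of $D$ (it is $K$ if there are none). Let $\star[X]$ be the semistar operation on $D[X]$ given by $E^{\star[X]}:=E[Y]_{\mathfrak S}\cap K(X)$, where $Y$ is a further indeterminate and $\mathfrak S:=D[X][Y]\setminus\bigcup Q[Y]$, the union over all prime ideals $Q$ of $D[X]$ with $Q\cap D=(0)$ or $(Q\cap D)^{\star_f}\subsetneq D^\star$. For $m\ge 1$ let $D[m]:=D[X_1,\dots,X_m]$,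 and define $\star[m]$ on $D[m]$ by $\star[1]:=\star[X_1]$ and $\star[m]:=(\star[m-1])[X_m]$ for $m\ge 2$. A $\star$-valuation overring of $D$ is a valuation ring $V$ with quotient field $K$ and $D\subseteq V\subseteq K$ ($V=K$ is allowed) such that $F^\star\subseteq FV$ for every nonzero finitely generated $D$-submodule $F$ of $K$. The $\star$-valuative dimension $\star\text{-}\dim_v(D)\in\{0,1,2,\dots\}\cup\{\infty\}$ is the supremum of the Krull dimensions of the $\star$-valuation overrings of $D$. Theorem 4.8. For every integral domain $D$, every semistar operation $\star$ on $D$ and every integer $m\ge 1$, $$\star[m]\text{-}\dim_v(D[m])=\widetilde\star\text{-}\dim_v(D)+m,$$ where $\infty+m=\infty$. -/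

import Mathlib

open Polynomial
open scoped Pointwise

universe u v

set_option linter.unusedSectionVars false

/-- A semistar operation on an integral domain `D` with quotient field `K`: a map `E ↦ E^⋆` from the
nonzero `D`-submodules of `K` to themselves with `(xE)^⋆ = xE^⋆` for `0 ≠ x ∈ K`, monotone, extensive
and idempotent. For convenience the map is extended to the zero submodule by the convention
`0^⋆ = 0`; that `E^⋆ ≠ 0` for `E ≠ 0` follows from `E ⊆ E^⋆`. -/
structure SemistarOperation (D : Type u) (K : Type v) [CommRing D] [IsDomain D] [Field K]
    [Algebra D K] [IsFractionRing D K] where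
  toFun : Submodule D K → Submodule D K
  map_bot : toFun ⊥ = ⊥
  map_smul : ∀ (x : K) (E : Submodule D K), x ≠ 0 → toFun (x • E) = x • toFun E
  mono : ∀ E F : Submodule D K, E ≤ F → toFun E ≤ toFun F
  le_self : ∀ E : Submodule D K, E ≤ toFun E
  idem : ∀ E : Submodule D K, toFun (toFun E) = toFun E

namespace SemistarOperation

section Basic

variable {D : Type u} {K : Type v} [CommRing D] [IsDomain D] [Field K] [Algebra D K]
  [IsFractionRing D K]

instance : CoeFun (SemistarOperation D K) fun _ => Submodule D K → Submodule D K := ⟨toFun⟩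

/-- In order to check `(xE)^⋆ = xE^⋆`, it is enough to check `x E^⋆ ⊆ (xE)^⋆`. -/
theorem map_smul_of_le (φ : Submodule D K → Submodule D K)
    (h : ∀ (x : K) (E : Submodule D K), x ≠ 0 → ∀ y ∈ φ E, x * y ∈ φ (x • E))
    (x : K) (E : Submodule D K) (hx : x ≠ 0) : φ (x • E) = x • φ E := by
  apply le_antisymm
  · intro y hy
    have h1 := h x⁻¹ (x • E) (inv_ne_zero hx) y hy
    rw [smul_smul, inv_mul_cancel₀ hx, one_smul] at h1
    refine Submodule.mem_smul_pointwise_iff_exists _ _ _ |>.2 ⟨x⁻¹ * y, h1, ?_⟩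
    rw [smul_eq_mul, ← mul_assoc, mul_inv_cancel₀ hx, one_mul]
  · intro y hy
    obtain ⟨z, hz, rfl⟩ := Submodule.mem_smul_pointwise_iff_exists _ _ _ |>.1 hy
    exact h x E hx z hz

theorem mul_mem_smul (x : K) {E : Submodule D K} {y : K} (hy : y ∈ E) : x * y ∈ x • E :=
  Submodule.smul_mem_pointwise_smul y x E hy

/-- `E^{⋆_f}`: the union of the `F^⋆`, for `F` a finitely generated `D`-submodule of `E`. -/
def finiteTypeSubmodule (star : SemistarOperation D K) (E : Submodule D K) : Submodule D K where
  carrier := {x | ∃ F : Submodule D K, F.FG ∧ F ≤ E ∧ x ∈ star F}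
  zero_mem' := ⟨⊥, Submodule.fg_bot, bot_le, zero_mem _⟩
  add_mem' := by
    rintro x y ⟨F, hF, hFE, hx⟩ ⟨G, hG, hGE, hy⟩
    exact ⟨F ⊔ G, hF.sup hG, sup_le hFE hGE,
      add_mem (star.mono _ _ le_sup_left hx) (star.mono _ _ le_sup_right hy)⟩
  smul_mem' := by
    rintro c x ⟨F, hF, hFE, hx⟩
    exact ⟨F, hF, hFE, Submodule.smul_mem _ c hx⟩

/-- The semistar operation of finite type `⋆_f` associated to `⋆`. -/
def finiteType (star : SemistarOperation D K) : SemistarOperation D K where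
  toFun := star.finiteTypeSubmodule
  map_bot := by
    rw [eq_bot_iff]
    rintro x ⟨F, -, hF, hx⟩
    rw [le_bot_iff.1 hF, star.map_bot] at hx
    exact hx
  map_smul := map_smul_of_le _ <| by
    rintro x E hx y ⟨F, hF, hFE, hy⟩
    refine ⟨x • F, hF.map _, Submodule.map_mono hFE, ?_⟩
    rw [star.map_smul x F hx]
    exact mul_mem_smul x hy
  mono := by
    rintro E F h x ⟨G, hG, hGE, hx⟩
    exact ⟨G, hG, hGE.trans h, hx⟩
  le_self := by
    intro E x hx
    exact ⟨Submodule.span D {x}, Submodule.fg_span_singleton x,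
      (Submodule.span_singleton_le_iff_mem x E).2 hx,
      star.le_self _ (Submodule.mem_span_singleton_self x)⟩
  idem := by
    intro E
    apply le_antisymm
    · rintro x ⟨F, hF, hFE, hx⟩
      obtain ⟨s, rfl⟩ := hF
      have key : ∀ t : Finset K, (t : Set K) ⊆ {x | ∃ F : Submodule D K, F.FG ∧ F ≤ E ∧ x ∈ star F} →
          ∃ G : Submodule D K, G.FG ∧ G ≤ E ∧ (t : Set K) ⊆ star G := by
        classical
        intro t
        induction t using Finset.induction_on with
        | empty => intro _; exact ⟨⊥, Submodule.fg_bot, bot_le, by simp⟩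
        | insert a t _ ih =>
          intro h
          rw [Finset.coe_insert, Set.insert_subset_iff] at h
          obtain ⟨G, hG, hGE, hGt⟩ := ih h.2
          obtain ⟨F, hF, hFE, ha⟩ := h.1
          refine ⟨F ⊔ G, hF.sup hG, sup_le hFE hGE, ?_⟩
          rw [Finset.coe_insert, Set.insert_subset_iff]
          exact ⟨star.mono _ _ le_sup_left ha,
            hGt.trans fun y hy => star.mono _ _ le_sup_right hy⟩
      obtain ⟨G, hG, hGE, hsG⟩ := key s (Submodule.span_le.1 hFE)
      refine ⟨G, hG, hGE, ?_⟩
      have := star.mono _ _ (Submodule.span_le.2 hsG) hx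
      rwa [star.idem] at this
    · rintro x ⟨F, hF, hFE, hx⟩
      refine ⟨F, hF, fun y hy => ?_, hx⟩
      exact ⟨F, hF, hFE, star.le_self _ hy⟩

/-- A quasi-`⋆`-ideal of `D`: a nonzero ideal `I` with `I^⋆ ∩ D = I`. -/
def IsQuasiIdeal (star : SemistarOperation D K) (I : Ideal D) : Prop :=
  I ≠ ⊥ ∧ (star (IsLocalization.coeSubmodule K I)).comap (Algebra.linearMap D K) = I

/-- A quasi-`⋆`-maximal ideal: a maximal element of the set of all proper quasi-`⋆`-ideals. -/
def IsQuasiMaximal (star : SemistarOperation D K) (P : Ideal D) : Prop :=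
  Maximal (fun I : Ideal D => I ≠ ⊤ ∧ star.IsQuasiIdeal I) P

/-- `E D_P`, the set of all fractions `e / s` with `e ∈ E` and `s ∈ D ∖ P`. -/
def localize (P : PrimeSpectrum D) (E : Submodule D K) : Submodule D K where
  carrier := {x | ∃ s : D, s ∉ P.asIdeal ∧ s • x ∈ E}
  zero_mem' := ⟨1, P.asIdeal.one_notMem, by simp⟩
  add_mem' := by
    rintro x y ⟨s, hs, hx⟩ ⟨t, ht, hy⟩
    refine ⟨s * t, fun h => (P.isPrime.mem_or_mem h).elim hs ht, ?_⟩
    rw [smul_add]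
    refine add_mem ?_ ?_
    · rw [mul_comm, mul_smul]
      exact E.smul_mem _ hx
    · rw [mul_smul]
      exact E.smul_mem _ hy
  smul_mem' := by
    rintro c x ⟨s, hs, hx⟩
    exact ⟨s, hs, by rw [smul_comm]; exact E.smul_mem _ hx⟩

theorem le_localize (P : PrimeSpectrum D) (E : Submodule D K) : E ≤ localize P E :=
  fun x hx => ⟨1, P.asIdeal.one_notMem, by simpa using hx⟩

open Classical in
/-- `⋂_{P ∈ Δ} E D_P` for `E ≠ 0` (which is `K` if `Δ` is empty), and `0` for `E = 0`. -/
noncomputable def spectralSubmodule (Δ : Set (PrimeSpectrum D)) (E : Submodule D K) :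
    Submodule D K :=
  if E = ⊥ then ⊥ else ⨅ P ∈ Δ, localize P E

theorem mem_spectralSubmodule {Δ : Set (PrimeSpectrum D)} {E : Submodule D K} (hE : E ≠ ⊥)
    {x : K} : x ∈ spectralSubmodule Δ E ↔ ∀ P ∈ Δ, x ∈ localize P E := by
  rw [spectralSubmodule, if_neg hE]
  simp only [Submodule.mem_iInf]

theorem le_spectralSubmodule (Δ : Set (PrimeSpectrum D)) (E : Submodule D K) :
    E ≤ spectralSubmodule Δ E := by
  by_cases hE : E = ⊥
  · rw [hE]; exact bot_le
  · exact fun x hx => (mem_spectralSubmodule hE).2 fun P _ => le_localize P E hx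

/-- The spectral semistar operation attached to a set `Δ` of primes of `D`. -/
noncomputable def spectral (Δ : Set (PrimeSpectrum D)) : SemistarOperation D K where
  toFun := spectralSubmodule Δ
  map_bot := if_pos rfl
  map_smul := map_smul_of_le _ <| by
    intro x E hx y hy
    by_cases hE : E = ⊥
    · rw [hE, spectralSubmodule, if_pos rfl, Submodule.mem_bot] at hy
      rw [hy, mul_zero]
      exact zero_mem _
    · have hxE : x • E ≠ ⊥ := by
        intro h
        apply hE
        rw [← one_smul K E, ← inv_mul_cancel₀ hx, mul_smul, h, Submodule.smul_bot']
      rw [mem_spectralSubmodule hE] at hy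
      rw [mem_spectralSubmodule hxE]
      intro P hP
      obtain ⟨s, hs, hsy⟩ := hy P hP
      exact ⟨s, hs, by rw [← mul_smul_comm]; exact mul_mem_smul x hsy⟩
  mono := by
    intro E F h x hx
    by_cases hE : E = ⊥
    · rw [hE, spectralSubmodule, if_pos rfl, Submodule.mem_bot] at hx
      rw [hx]
      exact zero_mem _
    · have hF : F ≠ ⊥ := fun h0 => hE (le_bot_iff.1 (h0 ▸ h))
      rw [mem_spectralSubmodule hE] at hx
      rw [mem_spectralSubmodule hF]
      intro P hP
      obtain ⟨s, hs, hsx⟩ := hx P hP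
      exact ⟨s, hs, h hsx⟩
  le_self := le_spectralSubmodule Δ
  idem := by
    intro E
    by_cases hE : E = ⊥
    · have h0 : spectralSubmodule Δ (⊥ : Submodule D K) = ⊥ := if_pos rfl
      rw [hE, h0, h0]
    · have hE' : spectralSubmodule Δ E ≠ ⊥ := fun h0 =>
        hE (le_bot_iff.1 (h0 ▸ le_spectralSubmodule Δ E))
      refine le_antisymm (fun x hx => ?_) (le_spectralSubmodule Δ _)
      rw [mem_spectralSubmodule hE'] at hx
      rw [mem_spectralSubmodule hE]
      intro P hP
      obtain ⟨s, hs, hsx⟩ := hx P hP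
      obtain ⟨t, ht, htx⟩ := (mem_spectralSubmodule hE).1 hsx P hP
      exact ⟨t * s, fun h => (P.isPrime.mem_or_mem h).elim ht hs, by rwa [mul_smul]⟩

/-- The stable semistar operation of finite type `⋆̃` associated to `⋆`:
`E ↦ ⋂ E D_P`, over the quasi-`⋆_f`-maximal ideals `P` of `D` (all of which are prime). -/
noncomputable def tilde (star : SemistarOperation D K) : SemistarOperation D K :=
  spectral {P | star.finiteType.IsQuasiMaximal P.asIdeal}

/-- `V` is a `⋆`-valuation overring of `D`: a valuation ring `D ⊆ V ⊆ K` of `K` (with `V = K`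
allowed) with `F^⋆ ⊆ FV` for every nonzero finitely generated fractional ideal `F` of `D`. -/
def IsValuationOverring (star : SemistarOperation D K) (V : ValuationSubring K) : Prop :=
  (∀ d : D, algebraMap D K d ∈ V) ∧
    ∀ F : Submodule D K, F.FG → F ≠ ⊥ → (star F : Set K) ⊆ Submodule.span V (F : Set K)

/-- The `⋆`-valuative dimension of `D`, that is, the supremum of the (Krull) dimensions of the
`⋆`-valuation overrings of `D`. Since `K` is always such an overring, this is a natural number `n`
exactly when `n` is the maximum of these dimensions, and it is `⊤` if there is no such maximum
in `ℕ`. -/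
noncomputable def valuativeDim (star : SemistarOperation D K) : WithBot ℕ∞ :=
  ⨆ (V : ValuationSubring K) (_ : star.IsValuationOverring V), ringKrullDim V

/-- The multiplicative subset `D[Y] ∖ ⋃_{Q ∈ Δ} Q[Y]` of `D[Y]`. -/
def polynomialSubmonoid (Δ : Set (PrimeSpectrum D)) : Submonoid D[X] where
  carrier := {f | ∀ Q ∈ Δ, f ∉ Ideal.map (C : D →+* D[X]) Q.asIdeal}
  one_mem' := fun Q _ =>
    (Ideal.isPrime_map_C_of_isPrime (P := Q.asIdeal)).one_notMem
  mul_mem' := by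
    intro f g hf hg Q hQ h
    exact ((Ideal.isPrime_map_C_of_isPrime (P := Q.asIdeal)).mem_or_mem h).elim (hf Q hQ) (hg Q hQ)

/-- `E[Y] ⊆ K[Y]`, the set of polynomials with coefficients in `E`. -/
def polynomialsOver (E : Submodule D K) : Submodule D K[X] where
  carrier := {g | ∀ n, g.coeff n ∈ E}
  zero_mem' := by simp
  add_mem' := by
    intro f g hf hg n
    rw [coeff_add]
    exact add_mem (hf n) (hg n)
  smul_mem' := by
    intro c f hf n
    rw [coeff_smul]
    exact E.smul_mem c (hf n)

theorem mul_map_mem_polynomialsOver {E : Submodule D K} {g : K[X]} (hg : g ∈ polynomialsOver E)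
    (t : D[X]) : g * t.map (algebraMap D K) ∈ polynomialsOver E := by
  intro n
  rw [coeff_mul]
  refine Submodule.sum_mem _ fun p _ => ?_
  rw [coeff_map, mul_comm, ← Algebra.smul_def]
  exact E.smul_mem _ (hg _)

/-- `E[Y]_S ∩ K` for a multiplicative subset `S` of `D[Y]` with `0 ∉ S`. An element `x` of `K` lies
in `E[Y]_S` iff `x = g / s` in `K(Y)`, i.e. `x s = g` in `K[Y]`, for some `s ∈ S`, `g ∈ E[Y]`. -/
def submonoidExtension (S : Submonoid D[X]) (E : Submodule D K) : Submodule D K where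
  carrier := {x | ∃ s ∈ S, C x * s.map (algebraMap D K) ∈ polynomialsOver E}
  zero_mem' := ⟨1, S.one_mem, by simp⟩
  add_mem' := by
    rintro x y ⟨s, hs, hx⟩ ⟨t, ht, hy⟩
    refine ⟨s * t, S.mul_mem hs ht, ?_⟩
    have h : C (x + y) * (s * t).map (algebraMap D K) =
        C x * s.map (algebraMap D K) * t.map (algebraMap D K) +
          C y * t.map (algebraMap D K) * s.map (algebraMap D K) := by
      rw [Polynomial.map_mul, C_add]; ring
    rw [h]
    exact add_mem (mul_map_mem_polynomialsOver hx t) (mul_map_mem_polynomialsOver hy s)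
  smul_mem' := by
    rintro c x ⟨s, hs, hx⟩
    refine ⟨s, hs, ?_⟩
    rw [← smul_C, smul_mul_assoc]
    exact Submodule.smul_mem _ c hx

theorem le_submonoidExtension (S : Submonoid D[X]) (E : Submodule D K) :
    E ≤ submonoidExtension S E := by
  intro x hx
  refine ⟨1, S.one_mem, fun n => ?_⟩
  rw [Polynomial.map_one, mul_one, coeff_C]
  split_ifs
  · exact hx
  · exact zero_mem _

/-- The semistar operation `E ↦ E[Y]_S ∩ K`. -/
def ofSubmonoid (S : Submonoid D[X]) (hS : (0 : D[X]) ∉ S) : SemistarOperation D K where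
  toFun := submonoidExtension S
  map_bot := by
    rw [eq_bot_iff]
    rintro x ⟨s, hs, hx⟩
    have h0 : C x * s.map (algebraMap D K) = 0 := by
      ext n
      simpa using hx n
    rcases mul_eq_zero.1 h0 with h | h
    · exact C_eq_zero.1 h
    · exfalso
      apply hS
      rwa [(Polynomial.map_eq_zero_iff (IsFractionRing.injective D K)).1 h] at hs
  map_smul := map_smul_of_le _ <| by
    rintro x E hx y ⟨s, hs, hy⟩
    refine ⟨s, hs, fun n => ?_⟩
    rw [C_mul, mul_assoc, coeff_C_mul]
    exact mul_mem_smul x (hy n)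
  mono := by
    rintro E F h x ⟨s, hs, hx⟩
    exact ⟨s, hs, fun n => h (hx n)⟩
  le_self := le_submonoidExtension S
  idem := by
    intro E
    apply le_antisymm
    · rintro x ⟨s, hs, hx⟩
      have hx' : ∀ n, ∃ t ∈ S, C ((C x * s.map (algebraMap D K)).coeff n) *
          t.map (algebraMap D K) ∈ polynomialsOver E := hx
      choose t ht h using hx'
      set g := C x * s.map (algebraMap D K) with hg
      refine ⟨s * ∏ n ∈ g.support, t n, S.mul_mem hs (S.prod_mem fun n _ => ht n), ?_⟩
      rw [Polynomial.map_mul, ← mul_assoc, ← hg]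
      intro k
      rw [coeff_mul]
      refine Submodule.sum_mem _ fun p _ => ?_
      by_cases hp : p.1 ∈ g.support
      · have h1 := mul_map_mem_polynomialsOver (h p.1) (∏ n ∈ g.support.erase p.1, t n) p.2
        rwa [mul_assoc, ← Polynomial.map_mul, Finset.mul_prod_erase _ _ hp, coeff_C_mul] at h1
      · rw [notMem_support_iff.1 hp, zero_mul]
        exact zero_mem _
    · exact le_submonoidExtension S _

/-- The primes `Q` of `D[X]` with `Q ∩ D = 0` or `(Q ∩ D)^{⋆_f} ⊊ D^⋆`. -/
def theta (star : SemistarOperation D K) : Set (PrimeSpectrum D[X]) :=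
  {Q | Q.asIdeal.comap (C : D →+* D[X]) = ⊥ ∨
    star.finiteType (IsLocalization.coeSubmodule K (Q.asIdeal.comap (C : D →+* D[X]))) <
      star (IsLocalization.coeSubmodule K ⊤)}

theorem zero_notMem_polynomialSubmonoid_theta (star : SemistarOperation D K) :
    (0 : D[X][X]) ∉ polynomialSubmonoid star.theta := by
  intro h
  refine h ⟨⊥, Ideal.isPrime_bot⟩ (Or.inl ?_) (zero_mem _)
  exact (RingHom.injective_iff_ker_eq_bot _).1 C_injective

/-- The operation `⋆[X]` on `D[X]`, with `L` the quotient field of `D[X]`: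
`E ↦ E[Y]_S ∩ L`, where `S = D[X][Y] ∖ ⋃ Q[Y]`, over the primes `Q` of `theta`. -/
noncomputable def polynomial (star : SemistarOperation D K) (L : Type*) [Field L]
    [Algebra D[X] L] [IsFractionRing D[X] L] : SemistarOperation D[X] L :=
  ofSubmonoid (polynomialSubmonoid star.theta) star.zero_notMem_polynomialSubmonoid_theta

end Basic

end SemistarOperation

/-- An integral domain together with a quotient field of it and a semistar operation. -/
structure SemistarDomain where
  ring : Type u
  field : Type u
  [commRing : CommRing ring]
  [isDomain : IsDomain ring]
  [isField : Field field]
  [algebra : Algebra ring field]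
  [isFractionRing : IsFractionRing ring field]
  star : SemistarOperation ring field

namespace SemistarDomain

attribute [instance] commRing isDomain isField algebra isFractionRing

/-- From `(D, ⋆)` to `(D[X], ⋆[X])`. -/
noncomputable def adjoinVar (A : SemistarDomain.{u}) : SemistarDomain.{u} where
  ring := A.ring[X]
  field := FractionRing A.ring[X]
  star := A.star.polynomial (FractionRing A.ring[X])

/-- From `(D, ⋆)` to `(D[m], ⋆[m])`, where `D[m] = D[X₁, …, X_m]` is `D[X₁, …, X_{m-1}][X_m]`
and `⋆[m] = ⋆[X₁, …, X_m]` is `(⋆[X₁, …, X_{m-1}])[X_m]`. -/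
noncomputable def adjoinVars (A : SemistarDomain.{u}) : ℕ → SemistarDomain.{u}
  | 0 => A
  | m + 1 => (adjoinVars A m).adjoinVar

end SemistarDomain

/-!
The valuation overrings of `(D[m], ⋆[m])` are understood through the *dense* ideals of `D`: the
finitely generated ideals `J` with `1 ∈ J^⋆`. They are closed under products, so by Zorn's lemma
an ideal containing no dense ideal lies in a prime of the same kind
(`Ideal.exists_le_maximal_avoiding`, `Ideal.isPrime_of_maximal_avoiding`). Two consequences follow.

* A valuation overring `V` of `D` is a `⋆̃`-valuation overring iff its center on `D` contains no
  dense ideal (`isValuationOverring_tilde_iff`): such a center is zero or lies in a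
  quasi-`⋆_f`-maximal ideal.
* A polynomial over `D[X]` belongs to the multiplicative set defining `⋆[X]` iff its content
  contains `J D[X]` for some dense `J`. Hence a valuation overring `W` of `D[X]` is a
  `⋆[X]`-valuation overring iff its center on `D` contains no dense ideal
  (`isValuationOverring_polynomial_iff`), and `⋆[X]` and its associated operation `(⋆[X])~` have
  the same valuation overrings (`valuativeDim_tilde_polynomial`). This reduces the formula to one
  indeterminate, by induction.

For one indeterminate, `W` is thus a `⋆[X]`-valuation overring iff it contains `D[X]` and its trace
`V = W ∩ K` is a `⋆̃`-valuation overring of `D`. It remains to compare dimensions. On the one hand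
`dim W ≤ dim V + 1`: if two steps of a chain of primes of `W` became equalities in `V`, elements `x`
and `y` chosen in these steps would have values independent modulo the value group of `V`, hence be
algebraically independent over `K`, although `K(X)` has transcendence degree one
(`ValuationSubring.ringKrullDim_le_ringKrullDim_comap_add_one`). On the other hand every `V` is the
trace of `V + X K[X]_(X)`, which has dimension at least `dim V + 1`, as `V` is its quotient by a
nonzero prime (`exists_comap_fieldEmbedding_eq`).
-/

/-! ### Prime ideals avoiding a family of finitely generated ideals -/

section Avoidance

variable {R : Type*} [CommRing R]

/-- Zorn's lemma applies because finitely generated ideals are compact. -/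
theorem Ideal.exists_le_maximal_avoiding (𝓙 : Set (Ideal R)) (hfg : ∀ J ∈ 𝓙, J.FG) (I : Ideal R)
    (hI : ∀ J ∈ 𝓙, ¬ J ≤ I) :
    ∃ Q, I ≤ Q ∧ Maximal (fun Q : Ideal R => ∀ J ∈ 𝓙, ¬ J ≤ Q) Q := by
  refine zorn_le_nonempty₀ {Q : Ideal R | ∀ J ∈ 𝓙, ¬ J ≤ Q} ?_ I hI
  intro c hc hchain y hy
  refine ⟨sSup c, fun J hJ hle => ?_, fun z hz => le_sSup hz⟩
  have hcomp := (Submodule.fg_iff_compact J).1 (hfg J hJ)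
  rw [CompleteLattice.isCompactElement_iff_le_of_directed_sSup_le] at hcomp
  obtain ⟨Q, hQ, hJQ⟩ := hcomp c ⟨y, hy⟩ hchain.directedOn hle
  exact hc hQ J hJ hJQ

theorem Ideal.isPrime_of_maximal_avoiding {𝓙 : Set (Ideal R)} (hne : 𝓙.Nonempty)
    (hmul : ∀ I ∈ 𝓙, ∀ J ∈ 𝓙, I * J ∈ 𝓙) {Q : Ideal R}
    (hQ : Maximal (fun Q : Ideal R => ∀ J ∈ 𝓙, ¬ J ≤ Q) Q) : Q.IsPrime := by
  have key : ∀ a, a ∉ Q → ∃ J ∈ 𝓙, J ≤ Q ⊔ Ideal.span {a} := by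
    intro a ha
    by_contra! h
    exact ha (hQ.2 h le_sup_left (le_sup_right (a := Q) (Ideal.mem_span_singleton_self a)))
  refine ⟨?_, ?_⟩
  · rintro rfl
    obtain ⟨J, hJ⟩ := hne
    exact hQ.1 J hJ le_top
  · intro a b hab
    by_contra! h
    obtain ⟨I, hI, hIa⟩ := key a h.1
    obtain ⟨J, hJ, hJb⟩ := key b h.2
    refine hQ.1 _ (hmul I hI J hJ) ((Ideal.mul_mono hIa hJb).trans ?_)
    rw [Ideal.sup_mul, Ideal.mul_sup, Ideal.mul_sup, Ideal.span_singleton_mul_span_singleton]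
    refine sup_le (sup_le Ideal.mul_le_left Ideal.mul_le_left) (sup_le Ideal.mul_le_right ?_)
    rwa [Ideal.span_singleton_le_iff_mem]

end Avoidance

/-! ### Centers and extended submodules for valuation rings -/

namespace ValuationSubring

variable {R L : Type*} [CommRing R] [Field L]

/-- The center on `R` of a valuation ring of `L`, along a ring homomorphism `f : R → L` whose values
lie in the valuation ring. -/
def center (V : ValuationSubring L) (f : R →+* L) (h : ∀ r, f r ∈ V) : Ideal R :=
  (IsLocalRing.maximalIdeal V).comap (f.codRestrict V.toSubring h)

theorem mem_center {V : ValuationSubring L} {f : R →+* L} {h : ∀ r, f r ∈ V} {r : R} :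
    r ∈ V.center f h ↔ V.valuation (f r) < 1 :=
  V.valuation_lt_one_iff _

theorem notMem_center {V : ValuationSubring L} {f : R →+* L} {h : ∀ r, f r ∈ V} {r : R} :
    r ∉ V.center f h ↔ V.valuation (f r) = 1 := by
  rw [mem_center, not_lt]
  exact ⟨fun h1 => le_antisymm ((V.valuation_le_one_iff _).2 (h r)) h1, fun h1 => h1.ge⟩

theorem valuation_lt_one_of_mem_span {V : ValuationSubring L} {s : Set L}
    (hs : ∀ y ∈ s, V.valuation y < 1) {x : L} (hx : x ∈ Submodule.span V s) :
    V.valuation x < 1 := by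
  induction hx using Submodule.span_induction with
  | mem y hy => exact hs y hy
  | zero => simp
  | add y z _ _ hy hz => exact V.valuation.map_add_lt hy hz
  | smul a y _ hy =>
    rw [Algebra.smul_def, map_mul]
    exact (mul_le_of_le_one_left' (V.valuation_le_one a)).trans_lt hy

/-- An element is in the `V`-span of any of its multiples by units of `V`. -/
theorem mem_span_of_mul_mem {V : ValuationSubring L} {s : Set L} {a x : L}
    (ha : V.valuation a = 1) (h : a * x ∈ s) : x ∈ Submodule.span V s := by
  have ha0 : a ≠ 0 := by
    rintro rfl
    simp at ha
  have hinv : a⁻¹ ∈ V := by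
    rw [← V.valuation_le_one_iff, map_inv₀, ha, inv_one]
  have h1 := Submodule.smul_mem _ (⟨a⁻¹, hinv⟩ : V) (Submodule.subset_span (R := V) h)
  have h2 : (⟨a⁻¹, hinv⟩ : V) • (a * x) = x := inv_mul_cancel_left₀ ha0 x
  rwa [h2] at h1

end ValuationSubring

namespace SemistarOperation

variable {D : Type u} {K : Type v} [CommRing D] [IsDomain D] [Field K] [Algebra D K]
  [IsFractionRing D K]

/-! ### Dense ideals -/

/-- A finitely generated ideal `J` of `D` is dense for `⋆` if `1 ∈ J^⋆`, that is, `J^⋆ = D^⋆`. -/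
def IsDense (star : SemistarOperation D K) (J : Ideal D) : Prop :=
  J.FG ∧ (1 : K) ∈ star (IsLocalization.coeSubmodule K J)

theorem IsDense.mul {star : SemistarOperation D K} {I J : Ideal D} (hI : star.IsDense I)
    (hJ : star.IsDense J) : star.IsDense (I * J) := by
  refine ⟨hI.1.mul hJ.1, ?_⟩
  have key : IsLocalization.coeSubmodule K I ≤ star (IsLocalization.coeSubmodule K (I * J)) := by
    intro x hx
    obtain ⟨a, ha, rfl⟩ := (IsLocalization.mem_coeSubmodule K I).1 hx
    by_cases ha0 : algebraMap D K a = 0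
    · rw [ha0]
      exact zero_mem _
    · have h := mul_mem_smul (algebraMap D K a) hJ.2
      rw [← star.map_smul _ _ ha0, mul_one] at h
      refine star.mono _ _ ?_ h
      intro y hy
      obtain ⟨z, hz, rfl⟩ := Submodule.mem_smul_pointwise_iff_exists _ _ _ |>.1 hy
      obtain ⟨b, hb, rfl⟩ := (IsLocalization.mem_coeSubmodule K J).1 hz
      exact (IsLocalization.mem_coeSubmodule K _).2 ⟨a * b, Ideal.mul_mem_mul ha hb, by simp⟩
  have h := star.mono _ _ key hI.2
  rwa [star.idem] at h

theorem one_mem_coeSubmodule_top : (1 : K) ∈ IsLocalization.coeSubmodule K (⊤ : Ideal D) := by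
  rw [IsLocalization.coeSubmodule_top]
  exact Submodule.one_le.1 le_rfl

theorem isDense_top (star : SemistarOperation D K) : star.IsDense ⊤ := by
  exact ⟨Ideal.fg_top D, star.le_self _ one_mem_coeSubmodule_top⟩

theorem IsDense.coeSubmodule_ne_bot {star : SemistarOperation D K} {J : Ideal D}
    (hJ : star.IsDense J) : IsLocalization.coeSubmodule K J ≠ ⊥ := by
  intro h
  have h1 := hJ.2
  rw [h, star.map_bot, Submodule.mem_bot] at h1
  exact one_ne_zero h1

/-- An ideal which contains no dense ideal, equivalently (`avoids_iff`) an ideal `I` such that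
`1 ∉ I^{⋆_f}`. -/
def Avoids (star : SemistarOperation D K) (I : Ideal D) : Prop :=
  ∀ J ∈ {J | star.IsDense J}, ¬ J ≤ I

theorem IsDense.one_mem_finiteType {star : SemistarOperation D K} {I J : Ideal D}
    (hJ : star.IsDense J) (h : J ≤ I) :
    (1 : K) ∈ star.finiteType (IsLocalization.coeSubmodule K I) :=
  ⟨_, (IsLocalization.coeSubmodule_fg K (IsFractionRing.injective D K) J).2 hJ.1,
    IsLocalization.coeSubmodule_mono K h, hJ.2⟩

theorem avoids_iff {star : SemistarOperation D K} {I : Ideal D} :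
    star.Avoids I ↔ (1 : K) ∉ star.finiteType (IsLocalization.coeSubmodule K I) := by
  refine ⟨?_, fun h J hJ hJI => h (hJ.one_mem_finiteType hJI)⟩
  rintro h ⟨F, hF, hFI, h1⟩
  have hFJ : IsLocalization.coeSubmodule K (F.comap (Algebra.linearMap D K)) = F := by
    rw [IsLocalization.coeSubmodule, Submodule.map_comap_eq_self]
    exact hFI.trans (LinearMap.map_le_range)
  refine h (F.comap (Algebra.linearMap D K)) ⟨?_, ?_⟩ ?_
  · refine (IsLocalization.coeSubmodule_fg K (IsFractionRing.injective D K) _).1 ?_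
    rwa [hFJ]
  · rwa [hFJ]
  · rwa [← IsFractionRing.coeSubmodule_le_coeSubmodule (K := K), hFJ]

theorem coeSubmodule_top_le_of_one_mem {E : Submodule D K} (h : (1 : K) ∈ E) :
    IsLocalization.coeSubmodule K (⊤ : Ideal D) ≤ E := by
  rwa [IsLocalization.coeSubmodule_top, Submodule.one_le]

theorem mem_theta_iff {star : SemistarOperation D K} {Q : PrimeSpectrum D[X]} :
    Q ∈ star.theta ↔ star.Avoids (Q.asIdeal.comap (C : D →+* D[X])) := by
  rw [avoids_iff]
  constructor
  · rintro (h | h) h1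
    · rw [h, IsLocalization.coeSubmodule_bot, star.finiteType.map_bot, Submodule.mem_bot] at h1
      exact one_ne_zero h1
    · refine h.not_ge ?_
      have h2 := star.finiteType.mono _ _ (coeSubmodule_top_le_of_one_mem h1)
      rw [star.finiteType.idem] at h2
      refine le_trans (fun x hx => ?_) h2
      exact ⟨_, (IsLocalization.coeSubmodule_fg K (IsFractionRing.injective D K) ⊤).2
        star.isDense_top.1, le_rfl, hx⟩
  · intro h
    refine Or.inr (lt_of_le_of_ne ?_ ?_)
    · rintro x ⟨F, -, hF, hx⟩
      exact star.mono _ _ (hF.trans (IsLocalization.coeSubmodule_mono K le_top)) hx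
    · intro h1
      rw [h1] at h
      exact h (star.le_self _ one_mem_coeSubmodule_top)

/-- The maximal elements among the ideals containing no dense ideal are, apart from zero, the
quasi-`⋆_f`-maximal ideals, whence they are prime. -/
theorem Avoids.exists_isQuasiMaximal {star : SemistarOperation D K} {I : Ideal D}
    (hI : star.Avoids I) (hI0 : I ≠ ⊥) :
    ∃ P : PrimeSpectrum D, star.finiteType.IsQuasiMaximal P.asIdeal ∧ I ≤ P.asIdeal := by
  obtain ⟨P, hIP, hP⟩ := Ideal.exists_le_maximal_avoiding {J | star.IsDense J}
    (fun J hJ => hJ.1) I hI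
  have hprime := Ideal.isPrime_of_maximal_avoiding (𝓙 := {J | star.IsDense J})
    ⟨⊤, star.isDense_top⟩ (fun I hI J hJ => IsDense.mul hI hJ) hP
  refine ⟨⟨P, hprime⟩, ⟨⟨hprime.ne_top, fun h => hI0 (le_bot_iff.1 (h ▸ hIP)), ?_⟩, ?_⟩, hIP⟩
  · have hle : P ≤ (star.finiteType (IsLocalization.coeSubmodule K P)).comap
        (Algebra.linearMap D K) := fun x hx =>
      star.finiteType.le_self _ ((IsLocalization.mem_coeSubmodule K P).2 ⟨x, hx, rfl⟩)
    refine le_antisymm (hP.2 (avoids_iff.2 fun h => ?_) hle) hle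
    refine avoids_iff.1 hP.1 ?_
    have h1 : IsLocalization.coeSubmodule K
        ((star.finiteType (IsLocalization.coeSubmodule K P)).comap (Algebra.linearMap D K)) ≤
          star.finiteType (IsLocalization.coeSubmodule K P) :=
      Submodule.map_comap_le _ _
    have h2 := star.finiteType.mono _ _ h1 h
    rwa [star.finiteType.idem] at h2
  · rintro J ⟨hJtop, -, hJ⟩ hPJ
    refine hP.2 (avoids_iff.2 fun h => hJtop ?_) hPJ
    rw [Ideal.eq_top_iff_one, ← hJ]
    simpa using h

/-! ### Valuation overrings and dense ideals -/

/-- A valuation ring `V` of a field `L` is compatible with `⋆` along `f : D → L` if `f D ⊆ V` and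
the center of `V` on `D` contains no dense ideal. -/
def IsCompatible (star : SemistarOperation D K) {L : Type*} [Field L] (f : D →+* L)
    (V : ValuationSubring L) : Prop :=
  (∀ d, f d ∈ V) ∧ ∀ J, star.IsDense J → ∃ d ∈ J, V.valuation (f d) = 1

theorem IsCompatible.avoids_center {star : SemistarOperation D K} {L : Type*} [Field L]
    {f : D →+* L} {V : ValuationSubring L} (h : star.IsCompatible f V) :
    star.Avoids (V.center f h.1) := by
  intro J hJ hle
  obtain ⟨d, hd, h1⟩ := h.2 J hJ
  exact ValuationSubring.notMem_center.2 h1 (hle hd)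

theorem IsValuationOverring.isCompatible {star : SemistarOperation D K} {V : ValuationSubring K}
    (h : star.IsValuationOverring V) : star.IsCompatible (algebraMap D K) V := by
  refine ⟨h.1, fun J hJ => ?_⟩
  have h1 : (1 : K) ∈ Submodule.span V (IsLocalization.coeSubmodule K J : Set K) :=
    h.2 _ ((IsLocalization.coeSubmodule_fg K (IsFractionRing.injective D K) J).2 hJ.1)
      hJ.coeSubmodule_ne_bot hJ.2
  by_contra! hc
  refine (ValuationSubring.valuation_lt_one_of_mem_span ?_ h1).ne (map_one _)
  intro y hy
  obtain ⟨d, hd, rfl⟩ := (IsLocalization.mem_coeSubmodule K J).1 hy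
  exact lt_of_le_of_ne ((V.valuation_le_one_iff _).2 (h.1 d)) (hc d hd)

theorem IsDense.tilde {star : SemistarOperation D K} {J : Ideal D} (hJ : star.IsDense J) :
    star.tilde.IsDense J := by
  refine ⟨hJ.1, (mem_spectralSubmodule hJ.coeSubmodule_ne_bot).2 ?_⟩
  rintro P ⟨⟨hPtop, -, hP⟩, -⟩
  have hJP : ¬ J ≤ P.asIdeal := by
    intro h
    refine hPtop ?_
    rw [Ideal.eq_top_iff_one, ← hP]
    simpa using hJ.one_mem_finiteType h
  obtain ⟨s, hs, hsP⟩ := SetLike.not_le_iff_exists.1 hJP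
  exact ⟨s, hsP, (IsLocalization.mem_coeSubmodule K J).2 ⟨s, hs, by simp [Algebra.smul_def]⟩⟩

/-- The `⋆̃`-valuation overrings of `D` are the valuation overrings whose center on `D` contains no
`⋆`-dense ideal. -/
theorem isValuationOverring_tilde_iff {star : SemistarOperation D K} {V : ValuationSubring K} :
    star.tilde.IsValuationOverring V ↔ star.IsCompatible (algebraMap D K) V := by
  refine ⟨fun h => ⟨h.1, fun J hJ => h.isCompatible.2 J hJ.tilde⟩, fun h => ⟨h.1, ?_⟩⟩
  intro F _ hF0 x hx
  by_cases hp : V.center (algebraMap D K) h.1 = ⊥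
  · -- All nonzero elements of `D` are units of `V`, hence `V = K`.
    have hunit : ∀ d : D, d ≠ 0 → V.valuation (algebraMap D K d) = 1 := fun d hd => by
      rw [← ValuationSubring.notMem_center (h := h.1), hp]
      exact hd
    have hV : ∀ z : K, z ∈ V := by
      intro z
      obtain ⟨a, b, hb, rfl⟩ := IsFractionRing.div_surjective (A := D) z
      rw [← V.valuation_le_one_iff, map_div₀, hunit b (nonZeroDivisors.ne_zero hb), div_one]
      exact (V.valuation_le_one_iff _).2 (h.1 a)
    obtain ⟨y, hy, hy0⟩ := Submodule.exists_mem_ne_zero_of_ne_bot hF0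
    have h1 := Submodule.smul_mem _ (⟨x / y, hV _⟩ : V) (Submodule.subset_span (R := V) hy)
    have h2 : (⟨x / y, hV _⟩ : V) • y = x := div_mul_cancel₀ x hy0
    rwa [h2] at h1
  · obtain ⟨P, hP, hle⟩ := h.avoids_center.exists_isQuasiMaximal hp
    obtain ⟨s, hs, hsx⟩ := (mem_spectralSubmodule hF0).1 hx P hP
    refine ValuationSubring.mem_span_of_mul_mem (a := algebraMap D K s)
      (ValuationSubring.notMem_center.1 fun h' => hs (hle h')) ?_
    rwa [← Algebra.smul_def]

/-! ### The operation `⋆[X]` -/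

/-- The ideals `J D[X]`, for `J` a dense ideal of `D`, replace the primes of `theta`: a polynomial
over `D[X]` is in the multiplicative set defining `⋆[X]` iff its content contains such an ideal. -/
theorem mem_polynomialSubmonoid_theta_iff {star : SemistarOperation D K} {s : D[X][X]} :
    s ∈ polynomialSubmonoid star.theta ↔
      ∃ J, star.IsDense J ∧ J.map (C : D →+* D[X]) ≤ Ideal.span (Set.range s.coeff) := by
  constructor
  · intro hs
    by_contra! hc
    obtain ⟨Q, hsQ, hQ⟩ := Ideal.exists_le_maximal_avoiding
      (Ideal.map (C : D →+* D[X]) '' {J | star.IsDense J})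
      (by rintro _ ⟨J, hJ, rfl⟩; exact hJ.1.map _) (Ideal.span (Set.range s.coeff))
      (by rintro _ ⟨J, hJ, rfl⟩; exact hc J hJ)
    have hprime := Ideal.isPrime_of_maximal_avoiding 
      (𝓙 := Ideal.map (C : D →+* D[X]) '' {J | star.IsDense J}) ⟨_, ⊤, star.isDense_top, rfl⟩ (by
      rintro _ ⟨I, hI, rfl⟩ _ ⟨J, hJ, rfl⟩
      exact ⟨I * J, IsDense.mul hI hJ, Ideal.map_mul _ _ _⟩) hQ
    refine hs ⟨Q, hprime⟩ (mem_theta_iff.2 fun J hJ hle => ?_) ?_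
    · exact hQ.1 _ ⟨J, hJ, rfl⟩ (Ideal.map_le_iff_le_comap.2 hle)
    · exact Ideal.mem_map_C_iff.2 fun n => hsQ (Ideal.subset_span ⟨n, rfl⟩)
  · rintro ⟨J, hJ, hle⟩ Q hQ hsQ
    refine mem_theta_iff.1 hQ J hJ (Ideal.map_le_iff_le_comap.1 (hle.trans ?_))
    rw [Ideal.span_le]
    rintro _ ⟨n, rfl⟩
    exact Ideal.mem_map_C_iff.1 hsQ n

theorem exists_span_range_coeff_eq {R : Type*} [CommRing R] {J : Ideal R} (hJ : J.FG) :
    ∃ s : R[X], Ideal.span (Set.range s.coeff) = J := by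
  obtain ⟨n, a, rfl⟩ := Submodule.fg_iff_exists_fin_generating_family.1 hJ
  have hcoeff : ∀ k, (∑ i : Fin n, monomial (i : ℕ) (a i)).coeff k =
      if h : k < n then a ⟨k, h⟩ else 0 := by
    intro k
    rw [finsetSum_coeff]
    split_ifs with h
    · rw [Finset.sum_eq_single ⟨k, h⟩]
      · simp
      · intro b _ hb
        rw [coeff_monomial, if_neg]
        exact fun h' => hb (Fin.ext h')
      · simp
    · refine Finset.sum_eq_zero fun i _ => ?_
      rw [coeff_monomial, if_neg]
      exact fun h' => h (h' ▸ i.2)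
  refine ⟨∑ i : Fin n, monomial (i : ℕ) (a i), le_antisymm ?_ ?_⟩
  · rw [Ideal.span_le]
    rintro _ ⟨k, rfl⟩
    rw [hcoeff]
    split_ifs with h
    · exact Submodule.subset_span ⟨_, rfl⟩
    · exact zero_mem _
  · refine Submodule.span_le.2 ?_
    rintro _ ⟨i, rfl⟩
    refine Ideal.subset_span ⟨i, ?_⟩
    rw [hcoeff, dif_pos i.2]

variable {L : Type*} [Field L] [Algebra D[X] L] [IsFractionRing D[X] L]

theorem isDense_polynomial_iff {star : SemistarOperation D K} {I : Ideal D[X]} :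
    (star.polynomial L).IsDense I ↔
      I.FG ∧ ∃ J, star.IsDense J ∧ J.map (C : D →+* D[X]) ≤ I := by
  refine and_congr_right fun _ => ⟨?_, ?_⟩
  · rintro ⟨s, hs, h⟩
    obtain ⟨J, hJ, hle⟩ := mem_polynomialSubmonoid_theta_iff.1 hs
    refine ⟨J, hJ, hle.trans (Ideal.span_le.2 ?_)⟩
    rintro _ ⟨n, rfl⟩
    have hn := h n
    rw [C_1, one_mul, coeff_map] at hn
    obtain ⟨a, ha, hb⟩ := (IsLocalization.mem_coeSubmodule L I).1 hn
    rwa [IsFractionRing.injective D[X] L hb] at ha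
  · rintro ⟨J, hJ, hle⟩
    obtain ⟨s, hs⟩ := exists_span_range_coeff_eq (hJ.1.map (C : D →+* D[X]))
    refine ⟨s, mem_polynomialSubmonoid_theta_iff.2 ⟨J, hJ, hs.ge⟩, fun n => ?_⟩
    rw [C_1, one_mul, coeff_map]
    exact (IsLocalization.mem_coeSubmodule L I).2
      ⟨_, hle (hs ▸ Ideal.subset_span ⟨n, rfl⟩), rfl⟩

theorem isCompatible_polynomial_iff {star : SemistarOperation D K} {W : ValuationSubring L} :
    (star.polynomial L).IsCompatible (algebraMap D[X] L) W ↔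
      (∀ p : D[X], algebraMap D[X] L p ∈ W) ∧
        star.IsCompatible ((algebraMap D[X] L).comp C) W := by
  constructor
  · refine fun h => ⟨h.1, fun d => h.1 _, fun J hJ => ?_⟩
    have hdense : (star.polynomial L).IsDense (J.map C) :=
      isDense_polynomial_iff.2 ⟨hJ.1.map _, J, hJ, le_rfl⟩
    by_contra! hc
    refine h.avoids_center _ hdense (Ideal.map_le_iff_le_comap.2 fun d hd => ?_)
    by_contra hd'
    exact hc d hd (ValuationSubring.notMem_center.1 hd')
  · rintro ⟨h, h'⟩
    refine ⟨h, fun I hI => ?_⟩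
    obtain ⟨-, J, hJ, hle⟩ := isDense_polynomial_iff.1 hI
    obtain ⟨d, hd, h1⟩ := h'.2 J hJ
    exact ⟨C d, hle (Ideal.mem_map_of_mem _ hd), h1⟩

theorem isValuationOverring_polynomial_iff {star : SemistarOperation D K}
    {W : ValuationSubring L} :
    (star.polynomial L).IsValuationOverring W ↔
      (∀ p : D[X], algebraMap D[X] L p ∈ W) ∧
        star.IsCompatible ((algebraMap D[X] L).comp C) W := by
  refine ⟨fun h => isCompatible_polynomial_iff.1 h.isCompatible, fun ⟨h, h'⟩ => ⟨h, ?_⟩⟩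
  rintro F - - x ⟨s, hs, hx⟩
  obtain ⟨J, hJ, hle⟩ := mem_polynomialSubmonoid_theta_iff.1 hs
  obtain ⟨d, hd, h1⟩ := h'.2 J hJ
  have hn : ∃ n, s.coeff n ∉ W.center (algebraMap D[X] L) h := by
    by_contra! hc
    refine ValuationSubring.notMem_center (h := h) |>.2 h1 ?_
    refine Ideal.span_le.2 ?_ (hle (Ideal.mem_map_of_mem _ hd))
    rintro _ ⟨n, rfl⟩
    exact hc n
  obtain ⟨n, hn⟩ := hn
  refine ValuationSubring.mem_span_of_mul_mem (ValuationSubring.notMem_center.1 hn) ?_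
  have := hx n
  rwa [coeff_C_mul, coeff_map, mul_comm] at this

/-- For an operation of the form `⋆[X]`, passing to the associated stable operation of finite type
does not change the valuation overrings. -/
theorem valuativeDim_tilde_polynomial (star : SemistarOperation D K) :
    (star.polynomial L).tilde.valuativeDim = (star.polynomial L).valuativeDim := by
  simp only [valuativeDim, isValuationOverring_tilde_iff, isCompatible_polynomial_iff,
    isValuationOverring_polynomial_iff]

end SemistarOperation

/-! ### Dimension of a valuation ring and of its trace on a subfield -/

/-- If, along any chain, a monotone map fails to be strictly increasing at most once, then it lowers
the Krull dimension by at most one. -/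
theorem Order.krullDim_le_krullDim_add_one {α β : Type*} [Preorder α] [PartialOrder β] (f : α → β)
    (hf : Monotone f)
    (h : ∀ a b c d, a < b → b ≤ c → c < d → f a < f b ∨ f c < f d) :
    Order.krullDim α ≤ Order.krullDim β + 1 := by
  classical
  rcases isEmpty_or_nonempty α with hα | ⟨⟨a₀⟩⟩
  · rw [Order.krullDim_eq_bot]
    exact bot_le
  have hβ : Nonempty β := ⟨f a₀⟩
  by_cases htop : Order.krullDim β = ⊤
  · rw [htop]
    exact le_top
  obtain ⟨n, hn⟩ : ∃ n : ℕ, Order.krullDim β = n := by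
    have h0 := Order.krullDim_nonneg (α := β)
    generalize Order.krullDim β = x at h0 htop
    induction x with
    | bot => simp at h0
    | coe x =>
      induction x with
      | top => exact absurd rfl htop
      | coe n => exact ⟨n, rfl⟩
  have hheight : ∀ b : β, Order.height b ≤ (n : ℕ∞) := fun b => by
    have := Order.height_le_krullDim b
    rw [hn] at this
    exact_mod_cast this
  have hfin : ∀ b : β, Order.height b < ⊤ := fun b => (hheight b).trans_lt (ENat.natCast_lt_top n)
  -- The height of the image, plus one as soon as a non-strict step has occurred below.
  set g : α → Prop := fun a => ∃ a' b', a' < b' ∧ b' ≤ a ∧ ¬ f a' < f b' with hg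
  set φ : α → ℕ := fun a => (Order.height (f a)).toNat + if g a then 1 else 0 with hφ
  have hmono : StrictMono φ := by
    intro a b hab
    have hgab : g a → g b := fun ⟨a', b', h1, h2, h3⟩ => ⟨a', b', h1, h2.trans hab.le, h3⟩
    by_cases hlt : f a < f b
    · have h1 : (Order.height (f a)).toNat < (Order.height (f b)).toNat := by
        have := Order.height_strictMono hlt (hfin _)
        rw [← ENat.natCast_toNat (hfin (f a)).ne, ← ENat.natCast_toNat (hfin (f b)).ne] at this
        exact_mod_cast this
      simp only [hφ]
      split_ifs with h2 h3
      · omega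
      · exact absurd (hgab h2) h3
      · omega
      · omega
    · have hle := ENat.toNat_le_toNat (Order.height_mono (hf hab.le)) (hfin _).ne
      have hb : g b := ⟨a, b, hab, le_rfl, hlt⟩
      have ha : ¬ g a := fun ⟨a', b', h1, h2, h3⟩ => (h a' b' a b h1 h2 hab).elim h3 hlt
      simp only [hφ, if_pos hb, if_neg ha]
      omega
  rw [hn, Order.krullDim]
  refine iSup_le fun p => ?_
  have h1 := (p.map φ hmono).head_add_length_le_nat
  have h2 : φ p.last ≤ n + 1 := by
    have h3 : (Order.height (f p.last)).toNat ≤ n := ENat.toNat_le_of_le_natCast (hheight _)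
    simp only [hφ]
    split_ifs <;> omega
  have h3 : p.length ≤ n + 1 := by
    rw [LTSeries.last_map, LTSeries.map_length] at h1
    omega
  exact_mod_cast h3

/-- In a vanishing sum of nonzero terms, two terms have the same value. -/
theorem Valuation.exists_ne_map_eq_of_sum_eq_zero {R Γ ι : Type*} [Ring R]
    [LinearOrderedCommMonoidWithZero Γ] (v : Valuation R Γ) {s : Finset ι} (hs : s.Nonempty)
    {f : ι → R} (hf : ∀ i ∈ s, v (f i) ≠ 0) (hsum : ∑ i ∈ s, f i = 0) :
    ∃ i ∈ s, ∃ j ∈ s, i ≠ j ∧ v (f i) = v (f j) := by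
  classical
  obtain ⟨j, hj, hmax⟩ := s.exists_max_image (fun i => v (f i)) hs
  by_contra! hc
  have h := v.map_sum_eq_of_lt hj (f := f) fun i hi => by
    obtain ⟨his, hij⟩ := Finset.mem_sdiff.1 hi
    exact lt_of_le_of_ne (hmax i his) (hc i his j hj (by simpa using hij))
  rw [hsum, map_zero] at h
  exact hf j hj h.symm

namespace ValuationSubring

variable {K : Type u} {L : Type v} [Field K] [Field L]

theorem mem_iff_mem_of_valuation_eq {W : ValuationSubring L} {Q : Ideal W} {a b : W}
    (h : W.valuation (a : L) = W.valuation (b : L)) : a ∈ Q ↔ b ∈ Q := by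
  obtain ⟨u, hu⟩ := (W.valuation_eq_iff _ _).1 h
  have : a = (u : W) * b := Subtype.ext hu.symm
  rw [this, Ideal.unit_mul_mem_iff_mem _ u.isUnit]

/-- Let `Q₀ ≤ Q₁ ≤ Q₂ ≤ Q₃` be primes of `W`, with `x ∈ Q₁ ∖ Q₀` and `y ∈ Q₃ ∖ Q₂`. If `Q₀` and `Q₁`
have the same elements in `K`, and so do `Q₂` and `Q₃`, then the ratio of two distinct monomials in
`x` and `y` never has the value of an element of `K`. By symmetry, the numerator may be taken to
have the lexicographically larger exponent. -/
theorem valuation_monomial_ne [Algebra K L] {W : ValuationSubring L} {Q₀ Q₁ Q₂ Q₃ : Ideal W}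
    [Q₀.IsPrime] [Q₁.IsPrime] [Q₂.IsPrime] [Q₃.IsPrime] (h01 : Q₀ ≤ Q₁) (h12 : Q₁ ≤ Q₂)
    (hK01 : ∀ a : W, (∃ k : K, algebraMap K L k = a) → a ∈ Q₁ → a ∈ Q₀)
    (hK23 : ∀ a : W, (∃ k : K, algebraMap K L k = a) → a ∈ Q₃ → a ∈ Q₂)
    {x y : W} (hx1 : x ∈ Q₁) (hx0 : x ∉ Q₀) (hy3 : y ∈ Q₃) (hy2 : y ∉ Q₂) {i j i' j' : ℕ}
    (hne : ¬ (i = i' ∧ j = j')) (hi : i' ≤ i) (hj : i = i' → j' ≤ j) (k : K) :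
    W.valuation (algebraMap K L k) * (W.valuation (x : L) ^ i' * W.valuation (y : L) ^ j') ≠
      W.valuation (x : L) ^ i * W.valuation (y : L) ^ j := by
  have hy1 : y ∉ Q₁ := fun h => hy2 (h12 h)
  have hy0 : y ∉ Q₀ := fun h => hy1 (h01 h)
  have hvx : W.valuation (x : L) ≠ 0 := by
    rw [Valuation.ne_zero_iff]
    intro h
    exact hx0 (by rw [show x = 0 from Subtype.ext h]; exact Q₀.zero_mem)
  have hvy : W.valuation (y : L) ≠ 0 := by
    rw [Valuation.ne_zero_iff]
    intro h
    exact hy2 (by rw [show y = 0 from Subtype.ext h]; exact Q₂.zero_mem)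
  -- No element of `K` has the value of an element of `W` in `Q₁ ∖ Q₀` or in `Q₃ ∖ Q₂`.
  have key : ∀ z : W, W.valuation (algebraMap K L k) = W.valuation (z : L) →
      (z ∈ Q₁ → z ∈ Q₀) ∧ (z ∈ Q₃ → z ∈ Q₂) := by
    intro z hz
    have hkW : algebraMap K L k ∈ W := by
      rw [← W.valuation_le_one_iff, hz]
      exact W.valuation_le_one z
    have hiff : ∀ Q : Ideal W, (⟨algebraMap K L k, hkW⟩ : W) ∈ Q ↔ z ∈ Q := fun Q =>
      mem_iff_mem_of_valuation_eq hz
    rw [← hiff, ← hiff, ← hiff, ← hiff]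
    exact ⟨hK01 _ ⟨k, rfl⟩, hK23 _ ⟨k, rfl⟩⟩
  intro heq
  rcases hi.eq_or_lt with rfl | hlt
  · obtain ⟨n, rfl⟩ := Nat.exists_eq_add_of_le (hj rfl)
    have hn : n ≠ 0 := by
      rintro rfl
      exact hne ⟨rfl, rfl⟩
    have h1 := (key (y ^ n) ?_).2 (Ideal.pow_mem_of_mem _ hy3 _ (Nat.pos_of_ne_zero hn))
    · exact hy2 (Ideal.IsPrime.mem_of_pow_mem inferInstance _ h1)
    · have : W.valuation (x : L) ^ i' * W.valuation (y : L) ^ j' ≠ 0 :=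
        mul_ne_zero (pow_ne_zero _ hvx) (pow_ne_zero _ hvy)
      refine mul_right_cancel₀ this ?_
      rw [heq]
      push_cast
      rw [map_pow, pow_add]
      ac_rfl
  · obtain ⟨n, rfl⟩ := Nat.exists_eq_add_of_lt hlt
    have hxn1 : x ^ (n + 1) ∈ Q₁ := Ideal.pow_mem_of_mem _ hx1 _ n.succ_pos
    have hxn0 : x ^ (n + 1) ∉ Q₀ := fun h => hx0 (Ideal.IsPrime.mem_of_pow_mem inferInstance _ h)
    rcases le_total j' j with hle | hle
    · obtain ⟨m, rfl⟩ := Nat.exists_eq_add_of_le hle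
      have h1 := (key (x ^ (n + 1) * y ^ m) ?_).1 (Ideal.mul_mem_right _ _ hxn1)
      · rcases Ideal.IsPrime.mem_or_mem inferInstance h1 with h | h
        · exact hxn0 h
        · exact hy0 (Ideal.IsPrime.mem_of_pow_mem inferInstance _ h)
      · have : W.valuation (x : L) ^ i' * W.valuation (y : L) ^ j' ≠ 0 :=
          mul_ne_zero (pow_ne_zero _ hvx) (pow_ne_zero _ hvy)
        refine mul_right_cancel₀ this ?_
        rw [heq]
        push_cast
        simp only [map_mul, map_pow, pow_add]
        ac_rfl
    · obtain ⟨m, rfl⟩ := Nat.exists_eq_add_of_le hle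
      have hym : y ^ m ∉ Q₁ := fun h => hy1 (Ideal.IsPrime.mem_of_pow_mem inferInstance _ h)
      -- `y ^ m` divides `x ^ (n + 1)` in `W`, as it is outside `Q₁`.
      have hdvd : y ^ m ∣ x ^ (n + 1) := by
        rcases ValuationRing.dvd_total (y ^ m) (x ^ (n + 1)) with h | h
        · exact h
        · exact absurd (Ideal.mem_of_dvd _ h hxn1) hym
      obtain ⟨z, hz⟩ := hdvd
      have hz1 : z ∈ Q₁ := by
        rw [hz] at hxn1
        exact (Ideal.IsPrime.mem_or_mem inferInstance hxn1).resolve_left hym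
      have hz0 : z ∉ Q₀ := fun h => hxn0 (hz ▸ Ideal.mul_mem_left _ _ h)
      refine hz0 ((key z ?_).1 hz1)
      have hzv : W.valuation (x : L) ^ (n + 1) =
          W.valuation (y : L) ^ m * W.valuation (z : L) := by
        rw [← map_pow, ← map_pow, ← map_mul]
        congr 1
        exact_mod_cast congrArg (Subtype.val) hz
      have : W.valuation (x : L) ^ i' * W.valuation (y : L) ^ (j + m) ≠ 0 :=
        mul_ne_zero (pow_ne_zero _ hvx) (pow_ne_zero _ hvy)
      refine mul_right_cancel₀ this ?_
      rw [heq, add_assoc, pow_add, hzv, pow_add]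
      ac_rfl

/-- Two steps `Q₀ ≤ Q₁` and `Q₂ ≤ Q₃` in the spectrum of `W` which become equalities in `K` produce
elements of `L` that are algebraically independent over `K`: by `valuation_monomial_ne`, no two
terms of a polynomial relation over `K` could have the same value. -/
theorem algebraicIndependent_of_collapsing_steps [Algebra K L] {W : ValuationSubring L}
    {Q₀ Q₁ Q₂ Q₃ : Ideal W}
    [Q₀.IsPrime] [Q₁.IsPrime] [Q₂.IsPrime] [Q₃.IsPrime] (h01 : Q₀ ≤ Q₁) (h12 : Q₁ ≤ Q₂)
    (hK01 : ∀ a : W, (∃ k : K, algebraMap K L k = a) → a ∈ Q₁ → a ∈ Q₀)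
    (hK23 : ∀ a : W, (∃ k : K, algebraMap K L k = a) → a ∈ Q₃ → a ∈ Q₂)
    {x y : W} (hx1 : x ∈ Q₁) (hx0 : x ∉ Q₀) (hy3 : y ∈ Q₃) (hy2 : y ∉ Q₂) :
    AlgebraicIndependent K ![(x : L), (y : L)] := by
  rw [algebraicIndependent_iff]
  intro p hp
  by_contra hp0
  have hvx : (x : L) ≠ 0 := by
    intro h
    exact hx0 (by rw [show x = 0 from Subtype.ext h]; exact Q₀.zero_mem)
  have hvy : (y : L) ≠ 0 := by
    intro h
    exact hy2 (by rw [show y = 0 from Subtype.ext h]; exact Q₂.zero_mem)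
  rw [MvPolynomial.aeval_def, MvPolynomial.eval₂_eq'] at hp
  simp only [Fin.prod_univ_two, Matrix.cons_val_zero, Matrix.cons_val_one] at hp
  obtain ⟨d, hd, e, he, hde, hv⟩ := W.valuation.exists_ne_map_eq_of_sum_eq_zero
    (MvPolynomial.support_nonempty.2 hp0) (fun d hd => by
      rw [Valuation.ne_zero_iff]
      have : algebraMap K L (p.coeff d) ≠ 0 := by
        rw [_root_.map_ne_zero]
        exact MvPolynomial.mem_support_iff.1 hd
      exact mul_ne_zero this (mul_ne_zero (pow_ne_zero _ hvx) (pow_ne_zero _ hvy))) hp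
  have hde' : ∀ {d e : Fin 2 →₀ ℕ}, d ≠ e → ¬ (d 0 = e 0 ∧ d 1 = e 1) := by
    rintro d e hde ⟨h0, h1⟩
    refine hde (Finsupp.ext fun i => ?_)
    fin_cases i
    · exact h0
    · exact h1
  have key : ∀ d ∈ p.support, ∀ e ∈ p.support, d ≠ e →
      W.valuation (algebraMap K L (p.coeff d) * ((x : L) ^ d 0 * (y : L) ^ d 1)) =
        W.valuation (algebraMap K L (p.coeff e) * ((x : L) ^ e 0 * (y : L) ^ e 1)) →
      e 0 ≤ d 0 → (d 0 = e 0 → e 1 ≤ d 1) → False := by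
    intro d hd e he hde hv h0 h1
    refine valuation_monomial_ne h01 h12 hK01 hK23 hx1 hx0 hy3 hy2 (hde' hde) h0 h1
      (p.coeff e / p.coeff d) ?_
    have hcd : W.valuation (algebraMap K L (p.coeff d)) ≠ 0 := by
      rw [Valuation.ne_zero_iff, _root_.map_ne_zero]
      exact MvPolynomial.mem_support_iff.1 hd
    simp only [map_mul, map_pow] at hv
    rw [map_div₀, map_div₀, div_mul_eq_mul_div, ← hv, mul_div_cancel_left₀ _ hcd]
  rcases lt_trichotomy (d 0) (e 0) with h | h | h
  · exact key e he d hd hde.symm hv.symm h.le fun h' => absurd h' h.ne'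
  · rcases le_total (e 1) (d 1) with h' | h'
    · exact key d hd e he hde hv h.ge fun _ => h'
    · exact key e he d hd hde.symm hv.symm h.le fun _ => h'
  · exact key d hd e he hde hv h.le fun h' => absurd h' h.ne'

/-- The inclusion in a valuation ring `W` of its trace `W.comap f` on a subfield. -/
def comapHom (W : ValuationSubring L) (f : K →+* L) : W.comap f →+* W :=
  (f.comp (W.comap f).subtype).codRestrict W.toSubring fun x => x.2

/-- A special case of Abhyankar's inequality: in an extension of transcendence degree at most one,
the dimension of a valuation ring exceeds that of its trace by at most one. -/
theorem ringKrullDim_le_ringKrullDim_comap_add_one [Algebra K L]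
    (htr : ∀ x y : L, ¬ AlgebraicIndependent K ![x, y]) (W : ValuationSubring L) :
    ringKrullDim W ≤ ringKrullDim (W.comap (algebraMap K L)) + 1 := by
  refine Order.krullDim_le_krullDim_add_one
    (PrimeSpectrum.comap (W.comapHom (algebraMap K L)))
    (fun P Q h => Ideal.comap_mono h) ?_
  intro Q₀ Q₁ Q₂ Q₃ h01 h12 h23
  by_contra! hc
  obtain ⟨x, hx1, hx0⟩ := SetLike.exists_of_lt (show Q₀.asIdeal < Q₁.asIdeal from h01)
  obtain ⟨y, hy3, hy2⟩ := SetLike.exists_of_lt (show Q₂.asIdeal < Q₃.asIdeal from h23)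
  have hK : ∀ P Q : PrimeSpectrum W, P ≤ Q →
      ¬ PrimeSpectrum.comap (W.comapHom (algebraMap K L)) P <
        PrimeSpectrum.comap (W.comapHom (algebraMap K L)) Q →
      ∀ a : W, (∃ k : K, algebraMap K L k = a) → a ∈ Q.asIdeal → a ∈ P.asIdeal := by
    rintro P Q hPQ hlt a ⟨k, hk⟩ haQ
    have hle : PrimeSpectrum.comap (W.comapHom (algebraMap K L)) P ≤
        PrimeSpectrum.comap (W.comapHom (algebraMap K L)) Q := Ideal.comap_mono hPQ
    have heq := hle.eq_of_not_lt hlt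
    have hkW : k ∈ W.comap (algebraMap K L) := by
      change algebraMap K L k ∈ W
      rw [hk]
      exact a.2
    have hka : W.comapHom (algebraMap K L) ⟨k, hkW⟩ = a := Subtype.ext hk
    have h1 : (⟨k, hkW⟩ : W.comap (algebraMap K L)) ∈
        (PrimeSpectrum.comap (W.comapHom (algebraMap K L)) Q).asIdeal := by
      change W.comapHom (algebraMap K L) ⟨k, hkW⟩ ∈ Q.asIdeal
      rwa [hka]
    rw [← heq] at h1
    change W.comapHom (algebraMap K L) ⟨k, hkW⟩ ∈ P.asIdeal at h1
    rwa [hka] at h1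
  exact htr x y (algebraicIndependent_of_collapsing_steps h01.le h12 (hK _ _ h01.le hc.1)
    (hK _ _ h23.le hc.2) hx1 hx0 hy3 hy2)

/-! ### Composition with the place `X ↦ 0` -/

section LaurentComposite

open scoped LaurentSeries PowerSeries

/-- The valuation ring `V + X K⟦X⟧` of the field `K⸨X⸩` of Laurent series, the composite of `K⟦X⟧`
with a valuation ring `V` of its residue field `K`. -/
noncomputable def laurentComposite (V : ValuationSubring K) : ValuationSubring K⸨X⸩ :=
  { (V.toSubring.comap (PowerSeries.constantCoeff (R := K))).map (algebraMap K⟦X⟧ K⸨X⸩) with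
    mem_or_inv_mem' := by
      have key : ∀ f : K⟦X⟧,
          (∃ g : K⟦X⟧, PowerSeries.constantCoeff g ∈ V ∧
            algebraMap K⟦X⟧ K⸨X⸩ g = algebraMap K⟦X⟧ K⸨X⸩ f) ∨
          ∃ g : K⟦X⟧, PowerSeries.constantCoeff g ∈ V ∧
            algebraMap K⟦X⟧ K⸨X⸩ g = (algebraMap K⟦X⟧ K⸨X⸩ f)⁻¹ := by
        intro f
        by_cases hf : PowerSeries.constantCoeff f ∈ V
        · exact Or.inl ⟨f, hf, rfl⟩
        · have h0 : PowerSeries.constantCoeff f ≠ 0 := fun h => hf (h ▸ V.zero_mem)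
          refine Or.inr ⟨f⁻¹, ?_, ?_⟩
          · rw [PowerSeries.constantCoeff_inv]
            exact (V.mem_or_inv_mem _).resolve_left hf
          · refine eq_inv_of_mul_eq_one_left ?_
            rw [← map_mul, PowerSeries.inv_mul_cancel _ h0, map_one]
      intro z
      rcases ValuationRing.isInteger_or_isInteger K⟦X⟧ z with ⟨f, rfl⟩ | ⟨f, hf⟩
      · exact key f
      · have hz : z = (algebraMap K⟦X⟧ K⸨X⸩ f)⁻¹ := by rw [hf, inv_inv]
        rw [hz, inv_inv]
        exact (key f).symm }

theorem algebraMap_mem_laurentComposite {V : ValuationSubring K} {f : K⟦X⟧} :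
    algebraMap K⟦X⟧ K⸨X⸩ f ∈ laurentComposite V ↔ PowerSeries.constantCoeff f ∈ V := by
  constructor
  · rintro ⟨g, hg, h⟩
    rwa [← IsFractionRing.injective K⟦X⟧ K⸨X⸩ h]
  · exact fun h => ⟨f, h, rfl⟩

/-- The residue homomorphism `V + X K⟦X⟧ → V`. -/
noncomputable def laurentCompositeResidue (V : ValuationSubring K) : laurentComposite V →+* V :=
  (((PowerSeries.constantCoeff (R := K)).comp
      (V.toSubring.comap (PowerSeries.constantCoeff (R := K))).subtype).codRestrict V.toSubring
        fun x => x.2).comp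
    ((V.toSubring.comap (PowerSeries.constantCoeff (R := K))).equivMapOfInjective
      (algebraMap K⟦X⟧ K⸨X⸩) (IsFractionRing.injective K⟦X⟧ K⸨X⸩)).symm.toRingHom

theorem laurentCompositeResidue_algebraMap {V : ValuationSubring K} {f : K⟦X⟧}
    (hf : PowerSeries.constantCoeff f ∈ V) :
    laurentCompositeResidue V ⟨algebraMap K⟦X⟧ K⸨X⸩ f, algebraMap_mem_laurentComposite.2 hf⟩ =
      ⟨PowerSeries.constantCoeff f, hf⟩ := by
  have h : (⟨algebraMap K⟦X⟧ K⸨X⸩ f, algebraMap_mem_laurentComposite.2 hf⟩ : laurentComposite V) =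
      (V.toSubring.comap (PowerSeries.constantCoeff (R := K))).equivMapOfInjective
        (algebraMap K⟦X⟧ K⸨X⸩) (IsFractionRing.injective K⟦X⟧ K⸨X⸩) ⟨f, hf⟩ := rfl
  rw [h]
  exact congrArg (((PowerSeries.constantCoeff (R := K)).comp
      (V.toSubring.comap (PowerSeries.constantCoeff (R := K))).subtype).codRestrict V.toSubring
        fun x => x.2) (RingEquiv.symm_apply_apply
    ((V.toSubring.comap (PowerSeries.constantCoeff (R := K))).equivMapOfInjective
      (algebraMap K⟦X⟧ K⸨X⸩) (IsFractionRing.injective K⟦X⟧ K⸨X⸩)) ⟨f, hf⟩)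

/-- The trace of `V + X K⟦X⟧` on a subfield of `K⸨X⸩` has the residue homomorphism to `V`. -/
noncomputable def laurentCompositeComapResidue (V : ValuationSubring K) (f : L →+* K⸨X⸩) :
    (laurentComposite V).comap f →+* V :=
  (laurentCompositeResidue V).comp ((laurentComposite V).comapHom f)

theorem coe_laurentCompositeComapResidue {V : ValuationSubring K} {f : L →+* K⸨X⸩} {z : L}
    (hz : z ∈ (laurentComposite V).comap f) {g : K⟦X⟧} (hg : f z = algebraMap K⟦X⟧ K⸨X⸩ g) :
    (laurentCompositeComapResidue V f ⟨z, hz⟩ : K) = PowerSeries.constantCoeff g := by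
  have hz' : f z ∈ laurentComposite V := hz
  have hgV : PowerSeries.constantCoeff g ∈ V := by
    rwa [hg, algebraMap_mem_laurentComposite] at hz'
  have h1 : (laurentComposite V).comapHom f ⟨z, hz⟩ =
      ⟨algebraMap K⟦X⟧ K⸨X⸩ g, algebraMap_mem_laurentComposite.2 hgV⟩ := Subtype.ext hg
  rw [laurentCompositeComapResidue, RingHom.comp_apply, h1, laurentCompositeResidue_algebraMap hgV]

end LaurentComposite

end ValuationSubring

/-! ### The dimension formula -/

theorem ValuationSubring.valuation_eq_one_iff_mem_and_inv_mem {K : Type*} [Field K]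
    {V : ValuationSubring K} {x : K} : V.valuation x = 1 ↔ x ≠ 0 ∧ x ∈ V ∧ x⁻¹ ∈ V := by
  rw [← V.valuation_le_one_iff, ← V.valuation_le_one_iff, map_inv₀]
  constructor
  · intro h
    refine ⟨?_, h.le, ?_⟩
    · rintro rfl
      simp at h
    · rw [h, inv_one]
  · rintro ⟨h0, h1, h2⟩
    have h3 : V.valuation x ≠ 0 := (Valuation.ne_zero_iff _).2 h0
    exact le_antisymm h1 ((inv_le_one₀ (zero_lt_iff.2 h3)).1 h2)

theorem WithBot.iSup_add_one_le {ι : Sort*} (f : ι → WithBot ℕ∞) (s : WithBot ℕ∞)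
    (h : ∀ i, f i + 1 ≤ s) : (⨆ i, f i) + 1 ≤ s := by
  have hbot : s ≤ 0 → (⨆ i, f i) = ⊥ := fun hs =>
    iSup_eq_bot.2 fun i => (ENat.WithBot.add_one_le_zero_iff _).1 ((h i).trans hs)
  induction s with
  | bot => rw [hbot bot_le, WithBot.bot_add]
  | coe s =>
    induction s with
    | top => exact le_top
    | coe n =>
      cases n with
      | zero =>
        rw [hbot le_rfl, WithBot.bot_add]
        exact bot_le
      | succ n =>
        have hn : (((n + 1 : ℕ) : ℕ∞) : WithBot ℕ∞) = (n : WithBot ℕ∞) + 1 := by norm_cast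
        rw [hn] at h ⊢
        exact ENat.WithBot.add_le_add_one_right_iff.2
          (iSup_le fun i => ENat.WithBot.add_le_add_one_right_iff.1 (h i))

namespace SemistarOperation

variable {D : Type u} {K : Type u} [CommRing D] [IsDomain D] [Field K] [Algebra D K]
  [IsFractionRing D K] {L : Type u} [Field L] [Algebra D[X] L] [IsFractionRing D[X] L]

theorem injective_algebraMap_comp_C :
    Function.Injective ((algebraMap D[X] L).comp (C : D →+* D[X])) :=
  (IsFractionRing.injective D[X] L).comp C_injective

variable (D K L) in
/-- The embedding of the quotient field of `D` in the quotient field of `D[X]`. -/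
noncomputable def fieldEmbedding : K →+* L :=
  IsFractionRing.lift (injective_algebraMap_comp_C (D := D) (L := L))

theorem fieldEmbedding_algebraMap (d : D) :
    fieldEmbedding D K L (algebraMap D K d) = algebraMap D[X] L (C d) :=
  IsFractionRing.lift_algebraMap _ d

theorem isCompatible_comap_fieldEmbedding_iff {star : SemistarOperation D K}
    {W : ValuationSubring L} :
    star.IsCompatible (algebraMap D K) (W.comap (fieldEmbedding D K L)) ↔
      star.IsCompatible ((algebraMap D[X] L).comp C) W := by
  have hmem : ∀ k : K, k ∈ W.comap (fieldEmbedding D K L) ↔ fieldEmbedding D K L k ∈ W :=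
    fun _ => Iff.rfl
  have hval : ∀ k : K, (W.comap (fieldEmbedding D K L)).valuation k = 1 ↔
      W.valuation (fieldEmbedding D K L k) = 1 := by
    intro k
    rw [ValuationSubring.valuation_eq_one_iff_mem_and_inv_mem,
      ValuationSubring.valuation_eq_one_iff_mem_and_inv_mem, hmem, hmem, map_inv₀,
      _root_.map_ne_zero]
  simp only [IsCompatible, hmem, hval, fieldEmbedding_algebraMap, RingHom.comp_apply]

/-- The quotient field of `D[X]` has transcendence degree one over that of `D`. -/
theorem not_algebraicIndependent_pair [Algebra K L]
    (hKL : algebraMap K L = fieldEmbedding D K L) (x y : L) :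
    ¬ AlgebraicIndependent K ![x, y] := by
  intro h
  let _ : Algebra D L := ((algebraMap D[X] L).comp C).toAlgebra
  have : IsScalarTower D D[X] L := .of_algebraMap_eq fun _ => rfl
  have : IsScalarTower D K L := .of_algebraMap_eq fun d => by
    rw [hKL, fieldEmbedding_algebraMap]
    rfl
  have : Algebra.IsAlgebraic D[X] L := IsLocalization.isAlgebraic L (nonZeroDivisors D[X])
  have h1 := (h.restrictScalars (IsFractionRing.injective D K)).lift_cardinalMk_le_trdeg
  rw [← trdeg_add_eq D D[X] (A := L), Polynomial.trdeg_of_isDomain,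
    trdeg_eq_zero, add_zero] at h1
  simp at h1

theorem ringKrullDim_le_comap_fieldEmbedding_add_one (W : ValuationSubring L) :
    ringKrullDim W ≤ ringKrullDim (W.comap (fieldEmbedding D K L)) + 1 := by
  let _ : Algebra K L := (fieldEmbedding D K L).toAlgebra
  exact W.ringKrullDim_le_ringKrullDim_comap_add_one (not_algebraicIndependent_pair rfl)

open scoped LaurentSeries PowerSeries

variable (D K) in
/-- The embedding `D[X] ⊆ K⸨X⸩`. -/
noncomputable def polynomialToLaurent : D[X] →+* K⸨X⸩ :=
  ((algebraMap K⟦X⟧ K⸨X⸩).comp Polynomial.coeToPowerSeries.ringHom).comp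
    (mapRingHom (algebraMap D K))

theorem polynomialToLaurent_injective : Function.Injective (polynomialToLaurent D K) :=
  ((IsFractionRing.injective K⟦X⟧ K⸨X⸩).comp (Polynomial.coe_injective K)).comp
    (Polynomial.map_injective _ (IsFractionRing.injective D K))

variable (D K L) in
/-- The embedding of the quotient field of `D[X]` in `K⸨X⸩`. -/
noncomputable def fieldToLaurent : L →+* K⸨X⸩ :=
  IsFractionRing.lift (polynomialToLaurent_injective (D := D) (K := K))

theorem fieldToLaurent_algebraMap (p : D[X]) : fieldToLaurent D K L (algebraMap D[X] L p) =
    algebraMap K⟦X⟧ K⸨X⸩ (p.map (algebraMap D K) : K[X]) :=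
  IsFractionRing.lift_algebraMap _ p

theorem fieldToLaurent_fieldEmbedding (k : K) :
    fieldToLaurent D K L (fieldEmbedding D K L k) =
      algebraMap K⟦X⟧ K⸨X⸩ (PowerSeries.C k) := by
  have h : (fieldToLaurent D K L).comp (fieldEmbedding D K L) =
      (algebraMap K⟦X⟧ K⸨X⸩).comp PowerSeries.C := by
    refine IsLocalization.ringHom_ext (nonZeroDivisors D) (RingHom.ext fun d => ?_)
    simp [fieldEmbedding_algebraMap, fieldToLaurent_algebraMap]
  exact RingHom.congr_fun h k

/-- Every valuation overring `V` of `D` is the trace of a valuation overring of `D[X]` of larger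
dimension, namely `V + X K[X]_(X)`, obtained here as the trace of `V + X K⟦X⟧`. -/
theorem exists_comap_fieldEmbedding_eq (V : ValuationSubring K)
    (hV : ∀ d : D, algebraMap D K d ∈ V) :
    ∃ W : ValuationSubring L, (∀ p : D[X], algebraMap D[X] L p ∈ W) ∧
      W.comap (fieldEmbedding D K L) = V ∧ ringKrullDim V + 1 ≤ ringKrullDim W := by
  have hW : ∀ p : D[X], algebraMap D[X] L p ∈
      V.laurentComposite.comap (fieldToLaurent D K L) := by
    intro p
    change fieldToLaurent D K L _ ∈ V.laurentComposite
    rw [fieldToLaurent_algebraMap, ValuationSubring.algebraMap_mem_laurentComposite,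
      Polynomial.constantCoeff_coe, coeff_map]
    exact hV _
  have hK : ∀ k : K, fieldEmbedding D K L k ∈ V.laurentComposite.comap (fieldToLaurent D K L) ↔
      k ∈ V := by
    intro k
    change fieldToLaurent D K L _ ∈ V.laurentComposite ↔ _
    rw [fieldToLaurent_fieldEmbedding, ValuationSubring.algebraMap_mem_laurentComposite,
      PowerSeries.constantCoeff_C]
  refine ⟨V.laurentComposite.comap (fieldToLaurent D K L), hW,
    ValuationSubring.ext _ _ hK, ?_⟩
  -- The residue homomorphism is onto `V` and kills `X`.
  refine ringKrullDim_succ_le_of_surjective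
    (V.laurentCompositeComapResidue (fieldToLaurent D K L))
    (fun k => ⟨⟨fieldEmbedding D K L k, (hK k).2 k.2⟩, Subtype.ext ?_⟩)
    (r := ⟨algebraMap D[X] L X, hW X⟩) (mem_nonZeroDivisors_of_ne_zero fun h => ?_)
    (Subtype.ext ?_)
  · rw [ValuationSubring.coe_laurentCompositeComapResidue _
      (fieldToLaurent_fieldEmbedding (D := D) (L := L) (k : K)), PowerSeries.constantCoeff_C]
  · exact X_ne_zero (IsFractionRing.injective D[X] L
      ((congrArg Subtype.val h).trans (map_zero _).symm))
  · rw [ValuationSubring.coe_laurentCompositeComapResidue _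
      (fieldToLaurent_algebraMap (K := K) (L := L) X), Polynomial.constantCoeff_coe, coeff_map,
      coeff_X_zero, map_zero]
    rfl

/-- The dimension formula for one indeterminate. -/
theorem valuativeDim_polynomial (star : SemistarOperation D K) :
    (star.polynomial L).valuativeDim = star.tilde.valuativeDim + 1 := by
  apply le_antisymm
  · refine iSup₂_le fun W hW => ?_
    rw [isValuationOverring_polynomial_iff, ← isCompatible_comap_fieldEmbedding_iff,
      ← isValuationOverring_tilde_iff] at hW
    have hle : ringKrullDim (W.comap (fieldEmbedding D K L)) ≤ star.tilde.valuativeDim :=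
      le_iSup₂_of_le (f := fun (V : ValuationSubring K) (_ : star.tilde.IsValuationOverring V) =>
        ringKrullDim V) _ hW.2 le_rfl
    exact (ringKrullDim_le_comap_fieldEmbedding_add_one W).trans (by gcongr)
  · refine WithBot.iSup_add_one_le _ _ fun V => WithBot.iSup_add_one_le _ _ fun hV => ?_
    obtain ⟨W, hW, hWV, hdim⟩ := exists_comap_fieldEmbedding_eq (L := L) V hV.1
    refine hdim.trans (le_iSup₂_of_le W ?_ le_rfl)
    rw [isValuationOverring_polynomial_iff, ← isCompatible_comap_fieldEmbedding_iff,
      ← isValuationOverring_tilde_iff, hWV]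
    exact ⟨hW, hV⟩

end SemistarOperation

theorem SemistarDomain.valuativeDim_adjoinVars_succ (A : SemistarDomain.{u}) (m : ℕ) :
    (A.adjoinVars (m + 1)).star.valuativeDim = A.star.tilde.valuativeDim + (m + 1 : ℕ) := by
  induction m with
  | zero =>
    exact_mod_cast A.star.valuativeDim_polynomial (L := FractionRing A.ring[X])
  | succ m ih =>
    have h1 : (A.adjoinVars (m + 1 + 1)).star.valuativeDim =
        (A.adjoinVars (m + 1)).star.tilde.valuativeDim + 1 :=
      (A.adjoinVars (m + 1)).star.valuativeDim_polynomial
        (L := FractionRing (A.adjoinVars (m + 1)).ring[X])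
    have h2 : (A.adjoinVars (m + 1)).star.tilde.valuativeDim =
        (A.adjoinVars (m + 1)).star.valuativeDim :=
      (A.adjoinVars m).star.valuativeDim_tilde_polynomial
        (L := FractionRing (A.adjoinVars m).ring[X])
    rw [h1, h2, ih, add_assoc, Nat.cast_succ (m + 1)]

theorem theorem4p8 (D K : Type u) [CommRing D] [IsDomain D] [Field K] [Algebra D K]
    [IsFractionRing D K] (star : SemistarOperation D K) (m : ℕ) (hm : 1 ≤ m) :
    ((SemistarDomain.mk D K star).adjoinVars m).star.valuativeDim =
      star.tilde.valuativeDim + (m : WithBot ℕ∞) := by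
  obtain ⟨n, rfl⟩ := Nat.exists_eq_succ_of_ne_zero (Nat.one_le_iff_ne_zero.1 hm)
  exact SemistarDomain.valuativeDim_adjoinVars_succ (SemistarDomain.mk D K star) n
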